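/- Setting. Consider $K$ agents and hypotheses $\Theta=\{1,\dots,H\}$, with true hypothesis $\theta_0\in\Theta$ and transmitted hypothesis $\theta_{\rm TX}\in\Theta$. Agent $k$ has for each $\theta\in\Theta$ a likelihood $L_{k,\theta}=L_k(\cdot|\theta)$, a probability density on its observation space $\mathcal X_k$ with respect to a $\sigma$-finite reference measure (Lebesgue measure for continuous observations, counting measure for discrete ones). At each instant $i\ge 1$ agent $k$ observes $\xi_{k,i}\sim L_{k,\theta_0}$; the vectors $(\xi_{1,i},\dots,\xi_{K,i})$, $i\ge1$, are independent over $i$, with arbitrary dependence across agents at the same instant. Let $A=[a_{\ell k}]$ be a combination matrix with $a_{\ell k}\ge 0$, $\sum_\ell a_{\ell k}=1$ for every $k$, and $a_{\ell k}=0$ if $\ell\notin\mathcal N_k$, where the neighborhood $\mathcal N_k$ of agent $k$ contains $k$. Starting from initial belief vectors $\mu_{k,0}$ (probability vectors on $\Theta$), the memory-aware strategy iterates for $i\ge1$ $$\psi_{k,i}(\theta)=\frac{L_k(\xi_{k,i}|\theta)\,\mu_{k,i-1}(\theta)}{\sum_{\tau}L_k(\xi_{k,i}|\tau)\,\mu_{k,i-1}(\tau)},\qquad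 \widehat\psi_{\ell k,i}(\theta)=\begin{cases}\psi_{\ell,i}(\theta_{\rm TX}),&\theta=\theta_{\rm TX},\\ \dfrac{\psi_{k,i}(\theta)}{1-\psi_{k,i}(\theta_{\rm TX})}\bigl(1-\psi_{\ell,i}(\theta_{\rm TX})\bigr),&\theta\ne\theta_{\rm TX},\end{cases}$$ $$\mu_{k,i}(\theta)=\frac{\prod_{\ell\in\mathcal N_k}\widehat\psi_{\ell k,i}(\theta)^{a_{\ell k}}}{\sum_{\tau}\prod_{\ell\in\mathcal N_k}\widehat\psi_{\ell k,i}(\tau)^{a_{\ell k}}}.$$ Let $\mathcal D_k=\{\theta: D_{\rm KL}(L_{k,\theta_0}\|L_{k,\theta})\ne0\}$ and $\mathcal I_k=\{\theta\ne\theta_0: D_{\rm KL}(L_{k,\theta_0}\|L_{k,\theta})=0\}$. Assumptions. (1) The network is strongly connected: any two agents are joined, in both directions, by a path of edges with nonzero weights, and $a_{kk}>0$ for at least one $k$. (2) $D_{\rm KL}(L_{k,\theta}\|L_{k,\theta'})<\infty$ for all $k,\theta,\theta'$. (3) $\mu_{k,0}(\theta)>0$ for all $k,\theta$. (4) For each $\theta\ne\theta_0$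 there is an agent $k$ with $\theta\in\mathcal D_k$. (5) For every $k$ with $\mathcal D_k\neq\emptyset$, $L_{k,\theta_0}$ is not (almost everywhere) equal to a convex combination of the $L_{k,\theta}$, $\theta\in\mathcal D_k$. Claim. There is exactly one vector $v$ with $Av=v$, $\sum_k v_k=1$ and $v_k>0$ for all $k$ (the Perron eigenvector). Let $\rho_k=\sum_{\theta\in\mathcal I_k}\mu_{k,0}(\theta)/\mu_{k,0}(\theta_0)$ and let $\rho=\prod_{k=1}^K\rho_k^{v_k}$ be the network confusion ratio. Then, for every agent $k$, as $i\to\infty$, $$\mu_{k,i}(\theta_{\rm TX})\to0\ \text{ a.s. if }\theta_{\rm TX}\ne\theta_0,\qquad \mu_{k,i}(\theta_{\rm TX})\to\frac1{1+\rho}\ \text{ a.s. if }\theta_{\rm TX}=\theta_0 .$$ Consequently, for every $\tau$ with $0<\tau<1/(1+\rho)$ and every agent $k$, the probability that the test "accept $\theta_{\rm TX}$ if $\mu_{k,i}(\theta_{\rm TX})>\tau$, reject it if $\mu_{k,i}(\theta_{\rm TX})\le\tau$" classifies $\theta_{\rm TX}$ correctly (i.e. accepts it if $\theta_{\rm TX}=\theta_0$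 and rejects it if $\theta_{\rm TX}\neq\theta_0$) tends to $1$ as $i\to\infty$. Moreover, with $\mu_{\min,0}=\min_{k,\theta}\mu_{k,0}(\theta)$ and any $0<\varepsilon<\mu_{\min,0}$, the choice $\tau=\mu_{\min,0}-\varepsilon$ satisfies $0<\tau<1/(1+\rho)$, so the test with this threshold has the same property. -/

import Mathlib

open MeasureTheory ProbabilityTheory Filter Topology
open scoped ENNReal NNReal BigOperators

namespace SocialLearning

/-! ### The network -/

/-- `A = [a_{ℓk}]` is a left-stochastic combination matrix adapted to the neighborhoods `N k`
(each of which contains the agent `k` itself): the entries are nonnegative, every column sums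
to one, and `a_{ℓk} = 0` whenever `ℓ` is not a neighbor of `k`. -/
structure IsCombinationMatrix {K : ℕ} (N : Fin K → Finset (Fin K))
    (A : Matrix (Fin K) (Fin K) ℝ) : Prop where
  self_mem : ∀ k, k ∈ N k
  nonneg : ∀ l k, 0 ≤ A l k
  col_sum : ∀ k, ∑ l, A l k = 1
  eq_zero : ∀ l k, l ∉ N k → A l k = 0

/-- The network is strongly connected: between any two agents there is a directed path all of
whose edges have nonzero weight, and at least one agent has a positive self-weight. -/
def StronglyConnected {K : ℕ} (A : Matrix (Fin K) (Fin K) ℝ) : Prop :=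
  (∀ l k, Relation.ReflTransGen (fun m n => A m n ≠ 0) l k) ∧ ∃ k, 0 < A k k

/-- `v` is a Perron eigenvector of `A`: `A v = v`, the entries sum to one and are positive. -/
structure IsPerronVector {K : ℕ} (A : Matrix (Fin K) (Fin K) ℝ) (v : Fin K → ℝ) : Prop where
  mulVec_eq : A.mulVec v = v
  sum_eq_one : ∑ k, v k = 1
  pos : ∀ k, 0 < v k

section Models

variable {K H : ℕ} {X : Fin K → Type*} [∀ k, MeasurableSpace (X k)]

/-! ### Likelihoods and observations -/

/-- `L k θ` is, for every agent `k` and hypothesis `θ`, a probability density on the observation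
space `X k` with respect to the reference measure `ν k` (Lebesgue measure for continuous
observations, counting measure for discrete ones). -/
structure IsLikelihoodModel (ν : ∀ k, Measure (X k)) (L : ∀ k, Fin H → X k → ℝ≥0) : Prop where
  measurable : ∀ k θ, Measurable (L k θ)
  lintegral_eq_one : ∀ k θ, ∫⁻ x, (L k θ x : ℝ≥0∞) ∂(ν k) = 1

/-- The distribution on `X k` with density `L k θ`. -/
noncomputable def law (ν : ∀ k, Measure (X k)) (L : ∀ k, Fin H → X k → ℝ≥0)
    (k : Fin K) (θ : Fin H) : Measure (X k) :=
  (ν k).withDensity fun x => (L k θ x : ℝ≥0∞)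

/-- The Kullback-Leibler divergence between the likelihoods of `θ` and `θ'` at agent `k`. -/
noncomputable def divergence (ν : ∀ k, Measure (X k)) (L : ∀ k, Fin H → X k → ℝ≥0)
    (k : Fin K) (θ θ' : Fin H) : ℝ≥0∞ :=
  InformationTheory.klDiv (law ν L k θ) (law ν L k θ')

/-- `ξ k i` is the observation of agent `k` at instant `i + 1`. Every observation of agent `k`
follows the true model of that agent, and the observations (of all agents jointly) are
independent over time. Dependence across agents at the same instant is arbitrary. -/
structure IsObservationProcess {Ω : Type*} [MeasurableSpace Ω] (P : Measure Ω)
    (ν : ∀ k, Measure (X k)) (L : ∀ k, Fin H → X k → ℝ≥0) (θ₀ : Fin H)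
    (ξ : ∀ k, ℕ → Ω → X k) : Prop where
  measurable : ∀ k i, Measurable (ξ k i)
  map_eq : ∀ k i, P.map (ξ k i) = law ν L k θ₀
  indep : iIndepFun (fun (i : ℕ) (ω : Ω) (k : Fin K) => ξ k i ω) P

open Classical in
/-- The distinguishable hypotheses of agent `k`. -/
noncomputable def distinguishable (ν : ∀ k, Measure (X k)) (L : ∀ k, Fin H → X k → ℝ≥0)
    (θ₀ : Fin H) (k : Fin K) : Finset (Fin H) :=
  Finset.univ.filter fun θ => divergence ν L k θ₀ θ ≠ 0

open Classical in
/-- The indistinguishable hypotheses of agent `k`. -/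
noncomputable def indistinguishable (ν : ∀ k, Measure (X k)) (L : ∀ k, Fin H → X k → ℝ≥0)
    (θ₀ : Fin H) (k : Fin K) : Finset (Fin H) :=
  Finset.univ.filter fun θ => θ ≠ θ₀ ∧ divergence ν L k θ₀ θ = 0

/-! ### Assumptions on likelihoods and initial beliefs -/

/-- All Kullback-Leibler divergences between likelihoods are finite. -/
def FiniteDivergences (ν : ∀ k, Measure (X k)) (L : ∀ k, Fin H → X k → ℝ≥0) : Prop :=
  ∀ k θ θ', divergence ν L k θ θ' < ∞

/-- Every initial belief is a probability vector with positive entries. -/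
structure IsPositiveInitialBelief (μ₀ : Fin K → Fin H → ℝ) : Prop where
  sum_eq_one : ∀ k, ∑ θ, μ₀ k θ = 1
  pos : ∀ k θ, 0 < μ₀ k θ

/-- Every false hypothesis is distinguishable for at least one agent. -/
def GloballyIdentifiable (ν : ∀ k, Measure (X k)) (L : ∀ k, Fin H → X k → ℝ≥0)
    (θ₀ : Fin H) : Prop :=
  ∀ θ, θ ≠ θ₀ → ∃ k, θ ∈ distinguishable ν L θ₀ k

/-- For an agent with distinguishable hypotheses, the true likelihood is not a convex combination
of the likelihoods of these (densities are compared up to null sets). -/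
def NotConvexCombination (ν : ∀ k, Measure (X k)) (L : ∀ k, Fin H → X k → ℝ≥0)
    (θ₀ : Fin H) : Prop :=
  ∀ k, (distinguishable ν L θ₀ k).Nonempty →
    ∀ α : Fin H → ℝ≥0, ∑ θ ∈ distinguishable ν L θ₀ k, α θ = 1 →
      ¬ (L k θ₀ =ᵐ[ν k] fun x => ∑ θ ∈ distinguishable ν L θ₀ k, α θ * L k θ x)

/-! ### The memory-aware strategy -/

/-- Bayesian update of the belief vector `m` with likelihood values `lik`. -/
noncomputable def bayesUpdate (lik : Fin H → ℝ≥0) (m : Fin H → ℝ) (θ : Fin H) : ℝ :=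
  (lik θ * m θ) / ∑ τ, lik τ * m τ

/-- Memory-aware filling: the belief vector that an agent with intermediate belief `ψself`
builds from the component `p` of the transmitted hypothesis `θTX` sent by a neighbor. -/
noncomputable def memoryFill (θTX : Fin H) (ψself : Fin H → ℝ) (p : ℝ) (θ : Fin H) : ℝ :=
  if θ = θTX then p else ψself θ / (1 - ψself θTX) * (1 - p)

/-- Weighted geometric average at agent `k`, before normalization, of the belief vectors that `k`
builds from the transmitted components of its neighbors. -/
noncomputable def geometricPool (N : Fin K → Finset (Fin K)) (A : Matrix (Fin K) (Fin K) ℝ)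
    (θTX : Fin H) (ψ : Fin K → Fin H → ℝ) (k : Fin K) (θ : Fin H) : ℝ :=
  ∏ l ∈ N k, memoryFill θTX (ψ k) (ψ l θTX) θ ^ A l k

/-- One step of the strategy: local Bayesian update from the observations `x` of the agents,
memory-aware filling, and normalized geometric averaging. -/
noncomputable def step (N : Fin K → Finset (Fin K)) (A : Matrix (Fin K) (Fin K) ℝ)
    (L : ∀ k, Fin H → X k → ℝ≥0) (θTX : Fin H) (x : ∀ k, X k) (m : Fin K → Fin H → ℝ)
    (k : Fin K) (θ : Fin H) : ℝ :=
  let ψ : Fin K → Fin H → ℝ := fun l => bayesUpdate (fun τ => L l τ (x l)) (m l)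
  geometricPool N A θTX ψ k θ / ∑ τ, geometricPool N A θTX ψ k τ

/-- The beliefs at instant `i`, where `x i` contains the observations at instant `i + 1`. -/
noncomputable def belief (N : Fin K → Finset (Fin K)) (A : Matrix (Fin K) (Fin K) ℝ)
    (L : ∀ k, Fin H → X k → ℝ≥0) (θTX : Fin H) (μ₀ : Fin K → Fin H → ℝ)
    (x : ℕ → ∀ k, X k) : ℕ → Fin K → Fin H → ℝ
  | 0 => μ₀
  | i + 1 => step N A L θTX (x i) (belief N A L θTX μ₀ x i)

/-! ### Confusion ratios and the minimal initial belief -/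

/-- The confusion ratio of agent `k`. -/
noncomputable def confusionRatio (ν : ∀ k, Measure (X k)) (L : ∀ k, Fin H → X k → ℝ≥0)
    (θ₀ : Fin H) (μ₀ : Fin K → Fin H → ℝ) (k : Fin K) : ℝ :=
  (∑ θ ∈ indistinguishable ν L θ₀ k, μ₀ k θ) / μ₀ k θ₀

/-- The network confusion ratio with weights `v`. -/
noncomputable def networkConfusionRatio (ν : ∀ k, Measure (X k)) (L : ∀ k, Fin H → X k → ℝ≥0)
    (θ₀ : Fin H) (μ₀ : Fin K → Fin H → ℝ) (v : Fin K → ℝ) : ℝ :=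
  ∏ k, confusionRatio ν L θ₀ μ₀ k ^ v k

/-- The smallest initial belief over all agents and hypotheses. -/
noncomputable def minInitialBelief (μ₀ : Fin K → Fin H → ℝ) : ℝ :=
  ⨅ q : Fin K × Fin H, μ₀ q.1 q.2

end Models

/-! ### The threshold test -/

/-- The threshold test accepts the transmitted hypothesis if its belief `b` exceeds `τ`. -/
def Accepts (τ b : ℝ) : Prop := τ < b

/-- The test classifies the transmitted hypothesis correctly: it accepts it exactly if it is the
true one. -/
def ClassifiesCorrectly {H : ℕ} (θ₀ θTX : Fin H) (τ b : ℝ) : Prop :=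
  Accepts τ b ↔ θTX = θ₀

end SocialLearning

namespace SocialLearning

open scoped Matrix

/-! ### Perron vector and diffusion over the network -/

section Network

variable {K : ℕ} {A : Matrix (Fin K) (Fin K) ℝ}

/-! Memory-aware filling makes the strategy linear in the log-odds `z k` of the transmitted
hypothesis. Every vector filled in by agent `k` has the proportions of `k`'s own intermediate belief
among the other hypotheses, so geometric pooling keeps these proportions and replaces `z` by `z ᵥ*
A`. Those proportions therefore evolve by local Bayesian updating alone, and the Bayes increment of
`z k` is the increment of the log-odds `g i k` of an isolated agent. Hence the network log-odds are
exactly `diffusion A g` (`belief_eq`).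

Diffusion conserves the Perron average, since `A v = v`, and contracts disagreement, since `A` is
primitive. So if `g i / s i` converges, every agent's state at scale `s` converges to the Perron
average of the limits (`tendsto_diffusion`). Two scales are needed.

At scale `i + 1`, the strong law turns log-likelihood ratios into divergences, and a sum of
exponentials grows like its largest term. The averaged rate is negative when the transmitted
hypothesis is false. It is positive when that hypothesis is true, has alternatives, and some agent
is not confused; then `ρ = 0`. The sigmoid gives the limits 0 and 1.

At scale 1, when the hypothesis is true and every agent is confused, the weights of
indistinguishable hypotheses stay at their priors and the other false ones vanish. Thus `g i k`
tends to `-log ρ_k`, and the sigmoid of the Perron average is `1 / (1 + ρ)`. -/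

theorem pow_entries_nonneg (h0 : ∀ l k, 0 ≤ A l k) (n : ℕ) (l k : Fin K) : 0 ≤ (A ^ n) l k := by
  induction n generalizing l k with
  | zero => rw [pow_zero, Matrix.one_apply]; split_ifs <;> norm_num
  | succ n ih =>
    rw [pow_succ, Matrix.mul_apply]
    exact Finset.sum_nonneg fun j _ => mul_nonneg (ih l j) (h0 j k)

theorem pow_col_sum (h1 : ∀ k, ∑ l, A l k = 1) (n : ℕ) (k : Fin K) : ∑ l, (A ^ n) l k = 1 := by
  induction n generalizing k with
  | zero => simp [Matrix.one_apply]
  | succ n ih =>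
    simp_rw [pow_succ, Matrix.mul_apply]
    rw [Finset.sum_comm]
    simp_rw [← Finset.sum_mul, ih, one_mul, h1]

theorem mul_entries_le_pow_add (h0 : ∀ l k, 0 ≤ A l k) (m n : ℕ) (l j k : Fin K) :
    (A ^ m) l j * (A ^ n) j k ≤ (A ^ (m + n)) l k := by
  rw [pow_add, Matrix.mul_apply]
  exact Finset.single_le_sum (f := fun j => (A ^ m) l j * (A ^ n) j k)
    (fun j _ => mul_nonneg (pow_entries_nonneg h0 m l j) (pow_entries_nonneg h0 n j k))
    (Finset.mem_univ j)

theorem exists_pow_entry_pos (h0 : ∀ l k, 0 ≤ A l k) {l k : Fin K}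
    (h : Relation.ReflTransGen (fun m n => A m n ≠ 0) l k) : ∃ n, 0 < (A ^ n) l k := by
  induction h with
  | refl => exact ⟨0, by simp⟩
  | @tail j k _ hjk ih =>
    obtain ⟨n, hn⟩ := ih
    refine ⟨n + 1, lt_of_lt_of_le ?_ (mul_entries_le_pow_add h0 n 1 l j k)⟩
    rw [pow_one]
    exact mul_pos hn (lt_of_le_of_ne (h0 j k) hjk.symm)

/-- A strongly connected network is primitive. -/
theorem exists_pow_entries_pos (h0 : ∀ l k, 0 ≤ A l k) (hconn : StronglyConnected A) :
    ∃ p, ∀ l k, 0 < (A ^ p) l k := by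
  obtain ⟨hpath, c, hc⟩ := hconn
  choose a ha using fun l => exists_pow_entry_pos h0 (hpath l c)
  choose b hb using fun k => exists_pow_entry_pos h0 (hpath c k)
  have hloop : ∀ n, 0 < (A ^ n) c c := by
    intro n
    induction n with
    | zero => simp
    | succ n ih =>
      refine lt_of_lt_of_le ?_ (mul_entries_le_pow_add h0 n 1 c c c)
      rw [pow_one]
      exact mul_pos ih hc
  -- Every pair is joined through `c`. The self-loop at `c` pads paths of different lengths to this
  -- common length.
  refine ⟨∑ l, a l + ∑ k, b k, fun l k => ?_⟩
  have hal : a l ≤ ∑ l, a l := Finset.single_le_sum (fun _ _ => Nat.zero_le _) (Finset.mem_univ l)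
  have hbk : b k ≤ ∑ k, b k := Finset.single_le_sum (fun _ _ => Nat.zero_le _) (Finset.mem_univ k)
  obtain ⟨r, hr⟩ : ∃ r, ∑ l, a l + ∑ k, b k = a l + r + b k :=
    ⟨∑ l, a l + ∑ k, b k - (a l + b k), by omega⟩
  rw [hr]
  refine lt_of_lt_of_le (mul_pos ?_ (hb k)) (mul_entries_le_pow_add h0 _ _ l c k)
  exact lt_of_lt_of_le (mul_pos (ha l) (hloop r)) (mul_entries_le_pow_add h0 _ _ l c c)

theorem pow_mulVec_eq {w : Fin K → ℝ} (hw : A *ᵥ w = w) (n : ℕ) : (A ^ n) *ᵥ w = w := by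
  induction n with
  | zero => simp
  | succ n ih => rw [pow_succ, ← Matrix.mulVec_mulVec, hw, ih]

/-- The all-ones row is fixed by `A`, so `A - 1` is singular and some `w ≠ 0` has `A w = w`. Then
`|w| ≤ A |w|` entrywise with equal total sums, which forces equality; a positive power of `A` makes
`|w|` positive. -/
theorem exists_perronVector (h0 : ∀ l k, 0 ≤ A l k) (h1 : ∀ k, ∑ l, A l k = 1)
    (hconn : StronglyConnected A) : ∃ v, IsPerronVector A v := by
  obtain ⟨p, hp⟩ := exists_pow_entries_pos h0 hconn
  obtain ⟨-, c, -⟩ := hconn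
  have hdet : (A - 1).det = 0 := by
    rw [← Matrix.exists_vecMul_eq_zero_iff]
    refine ⟨fun _ => 1, fun h => one_ne_zero (congrFun h c), ?_⟩
    ext k
    simp [Matrix.vecMul, dotProduct, h1, Matrix.one_apply]
  obtain ⟨w, hw0, hw⟩ := Matrix.exists_mulVec_eq_zero_iff.mpr hdet
  rw [Matrix.sub_mulVec, Matrix.one_mulVec, sub_eq_zero] at hw
  have hle : ∀ l, |w l| ≤ (A *ᵥ fun k => |w k|) l := by
    intro l
    calc |w l| = |∑ k, A l k * w k| := by conv_lhs => rw [← hw, Matrix.mulVec, dotProduct]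
      _ ≤ ∑ k, |A l k * w k| := Finset.abs_sum_le_sum_abs _ _
      _ = ∑ k, A l k * |w k| := Finset.sum_congr rfl fun k _ => by
        rw [abs_mul, abs_of_nonneg (h0 l k)]
  have hsum : ∑ l, |w l| = ∑ l, (A *ᵥ fun k => |w k|) l := by
    simp only [Matrix.mulVec, dotProduct]
    rw [Finset.sum_comm]
    simp_rw [← Finset.sum_mul, h1, one_mul]
  have habs : (A *ᵥ fun k => |w k|) = fun k => |w k| := by
    ext l
    exact ((Finset.sum_eq_sum_iff_of_le fun l _ => hle l).mp hsum l (Finset.mem_univ l)).symm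
  have hpos : ∀ l, 0 < |w l| := by
    intro l
    obtain ⟨j, hj⟩ := Function.ne_iff.mp hw0
    have := congrFun (pow_mulVec_eq habs p) l
    rw [← this]
    refine Finset.sum_pos' (fun k _ => mul_nonneg (hp l k).le (abs_nonneg _))
      ⟨j, Finset.mem_univ j, mul_pos (hp l j) (abs_pos.mpr hj)⟩
  have hS : 0 < ∑ l, |w l| := Finset.sum_pos (fun l _ => hpos l) ⟨c, Finset.mem_univ c⟩
  refine ⟨(∑ l, |w l|)⁻¹ • fun k => |w k|, ?_, ?_, fun k => ?_⟩
  · rw [Matrix.mulVec_smul, habs]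
  · simp only [Pi.smul_apply, smul_eq_mul]
    rw [← Finset.mul_sum, inv_mul_cancel₀ hS.ne']
  · exact mul_pos (inv_pos.mpr hS) (hpos k)

theorem IsPerronVector.dotProduct_vecMul {v : Fin K → ℝ} (hv : IsPerronVector A v)
    (x : Fin K → ℝ) : x ᵥ* A ⬝ᵥ v = x ⬝ᵥ v := by
  rw [← Matrix.dotProduct_mulVec, hv.mulVec_eq]

theorem norm_vecMul_le (h0 : ∀ l k, 0 ≤ A l k) (h1 : ∀ k, ∑ l, A l k = 1) (x : Fin K → ℝ) :
    ‖x ᵥ* A‖ ≤ ‖x‖ := by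
  refine (pi_norm_le_iff_of_nonneg (norm_nonneg x)).mpr fun k => ?_
  calc ‖(x ᵥ* A) k‖ ≤ ∑ l, ‖x l * A l k‖ := by
        rw [Matrix.vecMul, dotProduct]
        exact norm_sum_le _ _
    _ ≤ ∑ l, ‖x‖ * A l k := Finset.sum_le_sum fun l _ => by
        rw [norm_mul, Real.norm_of_nonneg (h0 l k)]
        exact mul_le_mul_of_nonneg_right (norm_le_pi_norm x l) (h0 l k)
    _ = ‖x‖ := by rw [← Finset.mul_sum, h1, mul_one]

/-- A power of a primitive combination matrix contracts the vectors orthogonal to the Perron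
eigenvector. -/
theorem exists_pow_contraction (h0 : ∀ l k, 0 ≤ A l k) (h1 : ∀ k, ∑ l, A l k = 1)
    (hconn : StronglyConnected A) {v : Fin K → ℝ} (hv : IsPerronVector A v) :
    ∃ p, 0 < p ∧ ∃ r : ℝ, 0 ≤ r ∧ r < 1 ∧ ∀ x, x ⬝ᵥ v = 0 → ‖x ᵥ* A ^ p‖ ≤ r * ‖x‖ := by
  obtain ⟨q, hq⟩ := exists_pow_entries_pos h0 hconn
  obtain ⟨-, c, -⟩ := hconn
  -- With a single agent the exponent `q` may be zero, so it is increased by one.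
  have hp : ∃ p, 0 < p ∧ ∀ l k, 0 < (A ^ p) l k := by
    refine ⟨q + 1, q.succ_pos, fun l k => ?_⟩
    obtain ⟨j, hj⟩ : ∃ j, A j k ≠ 0 := by
      by_contra! h
      have := h1 k
      simp [h] at this
    refine lt_of_lt_of_le ?_ (mul_entries_le_pow_add h0 q 1 l j k)
    rw [pow_one]
    exact mul_pos (hq l j) (lt_of_le_of_ne (h0 j k) hj.symm)
  obtain ⟨p, hp0, hp⟩ := hp
  have : Nonempty (Fin K × Fin K) := ⟨(c, c)⟩
  obtain ⟨⟨a, b⟩, hab⟩ := Finite.exists_min fun q : Fin K × Fin K => (A ^ p) q.1 q.2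
  set β := (A ^ p) a b with hβ
  have hβ0 : 0 < β := hp a b
  have hβle : ∀ l k, β ≤ (A ^ p) l k := fun l k => hab (l, k)
  have hβ1 : β ≤ 1 := by
    rw [← pow_col_sum h1 p b]
    exact Finset.single_le_sum (f := fun l => (A ^ p) l b) (fun l _ => (hp l b).le)
      (Finset.mem_univ a)
  have hv1 : ∀ l, v l ≤ 1 := fun l => by
    rw [← hv.sum_eq_one]
    exact Finset.single_le_sum (fun l _ => (hv.pos l).le) (Finset.mem_univ l)
  refine ⟨p, hp0, 1 - β, by linarith, by linarith, fun x hx => ?_⟩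
  refine (pi_norm_le_iff_of_nonneg (mul_nonneg (by linarith) (norm_nonneg x))).mpr fun k => ?_
  have hnn : ∀ l, 0 ≤ (A ^ p) l k - β * v l := fun l => by
    nlinarith [hβle l k, hv1 l]
  -- Doeblin's argument: as `x ⬝ᵥ v = 0`, subtracting `β v` from each column changes nothing, and
  -- leaves nonnegative weights of total mass `1 - β`.
  have hEq : (x ᵥ* A ^ p) k = ∑ l, x l * ((A ^ p) l k - β * v l) := by
    simp only [Matrix.vecMul, dotProduct] at hx ⊢
    simp_rw [mul_sub, Finset.sum_sub_distrib, mul_left_comm _ β, ← Finset.mul_sum, hx, mul_zero,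
      sub_zero]
  rw [hEq]
  calc ‖∑ l, x l * ((A ^ p) l k - β * v l)‖
      ≤ ∑ l, ‖x l * ((A ^ p) l k - β * v l)‖ := norm_sum_le _ _
    _ ≤ ∑ l, ‖x‖ * ((A ^ p) l k - β * v l) := Finset.sum_le_sum fun l _ => by
        rw [norm_mul, Real.norm_of_nonneg (hnn l)]
        exact mul_le_mul_of_nonneg_right (norm_le_pi_norm x l) (hnn l)
    _ = (1 - β) * ‖x‖ := by
        rw [← Finset.mul_sum, Finset.sum_sub_distrib, ← Finset.mul_sum, pow_col_sum h1,
          hv.sum_eq_one]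
        ring

theorem tendsto_zero_of_delayed_contraction {b c : ℕ → ℝ} {p : ℕ} (hp : 0 < p) {r : ℝ}
    (hr0 : 0 ≤ r) (hr1 : r < 1) (hb : ∀ n, 0 ≤ b n) (hrec : ∀ n, b (n + p) ≤ r * b n + c n)
    (hc : Tendsto c atTop (𝓝 0)) : Tendsto b atTop (𝓝 0) := by
  have key : ∀ ε > 0, ∀ᶠ n in atTop, b n < ε := by
    intro ε hε
    -- This bound makes `ε / 2` a fixed point of `t ↦ r * t + (1 - r) * (ε / 2)`; the excess over it
    -- shrinks by `r` every `p` steps.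
    have hcε : ∀ᶠ n in atTop, c n < (1 - r) * (ε / 2) :=
      hc.eventually_lt_const (mul_pos (by linarith) (by linarith))
    obtain ⟨M, hM⟩ := eventually_atTop.mp hcε
    set C := ∑ j ∈ Finset.range p, b (M + j)
    have hgeo : ∀ q j, j < p → b (M + j + q * p) ≤ ε / 2 + r ^ q * C := by
      intro q j hj
      induction q with
      | zero =>
        have : b (M + j) ≤ C := Finset.single_le_sum (f := fun j => b (M + j))
          (fun j _ => hb _) (Finset.mem_range.mpr hj)
        simp only [zero_mul, add_zero, pow_zero, one_mul]
        linarith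
      | succ q ih =>
        have h1 := hrec (M + j + q * p)
        have h2 := hM (M + j + q * p) (by omega)
        have h3 := mul_le_mul_of_nonneg_left ih hr0
        have h4 : M + j + (q + 1) * p = M + j + q * p + p := by ring
        rw [h4, pow_succ]
        nlinarith
    have hlim : Tendsto (fun n : ℕ => r ^ ((n - M) / p) * C) atTop (𝓝 0) := by
      have h1 : Tendsto (fun n : ℕ => (n - M) / p) atTop atTop :=
        (Nat.tendsto_div_const_atTop hp.ne').comp (tendsto_sub_atTop_nat M)
      simpa using ((tendsto_pow_atTop_nhds_zero_of_lt_one hr0 hr1).comp h1).mul_const C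
    filter_upwards [hlim.eventually_lt_const (half_pos hε), eventually_ge_atTop M] with n hn hMn
    have h1 := hgeo ((n - M) / p) ((n - M) % p) (Nat.mod_lt _ hp)
    have h2 : M + (n - M) % p + (n - M) / p * p = n := by
      have := Nat.mod_add_div (n - M) p
      rw [mul_comm] at this
      omega
    rw [h2] at h1
    linarith
  rw [Metric.tendsto_atTop']
  intro ε hε
  obtain ⟨M, hM⟩ := eventually_atTop.mp (key ε hε)
  exact ⟨M, fun n hn => by
    rw [Real.dist_eq, sub_zero, abs_of_nonneg (hb n)]; exact hM n hn.le⟩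

/-- Consensus on the complement of the Perron eigenvector, at the scale `s`. -/
theorem tendsto_disagreement_zero (h0 : ∀ l k, 0 ≤ A l k) (h1 : ∀ k, ∑ l, A l k = 1)
    (hconn : StronglyConnected A) {v : Fin K → ℝ} (hv : IsPerronVector A v)
    {s : ℕ → ℝ} (hs : Monotone s) (hs0 : ∀ i, 0 < s i) {e d : ℕ → Fin K → ℝ}
    (he0 : e 0 ⬝ᵥ v = 0) (hd0 : ∀ i, d i ⬝ᵥ v = 0) (hrec : ∀ i, e (i + 1) = (e i + d i) ᵥ* A)
    (hd : Tendsto (fun i => ‖d i‖ / s i) atTop (𝓝 0)) :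
    Tendsto (fun i => ‖e i‖ / s i) atTop (𝓝 0) := by
  obtain ⟨p, hp, r, hr0, hr1, hcontr⟩ := exists_pow_contraction h0 h1 hconn hv
  have he : ∀ i, e i ⬝ᵥ v = 0 := by
    intro i
    induction i with
    | zero => exact he0
    | succ i ih => rw [hrec, hv.dotProduct_vecMul, add_dotProduct, ih, hd0, add_zero]
  -- Comparison with the undisturbed evolution: only a power of `A` contracts, while single steps do
  -- not expand, so the disturbances at most add up.
  have hstep : ∀ n j, ‖e (n + j) - e n ᵥ* A ^ j‖ ≤ ∑ i ∈ Finset.range j, ‖d (n + i)‖ := by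
    intro n j
    induction j with
    | zero => simp
    | succ j ih =>
      have h2 : e (n + (j + 1)) - e n ᵥ* A ^ (j + 1)
          = ((e (n + j) - e n ᵥ* A ^ j) + d (n + j)) ᵥ* A := by
        rw [← add_assoc, hrec, pow_succ, ← Matrix.vecMul_vecMul, ← Matrix.sub_vecMul]
        congr 1
        abel
      rw [h2, Finset.sum_range_succ]
      exact (norm_vecMul_le h0 h1 _).trans ((norm_add_le _ _).trans (by gcongr))
  refine tendsto_zero_of_delayed_contraction hp hr0 hr1
    (c := fun n => ∑ i ∈ Finset.range p, ‖d (n + i)‖ / s (n + i))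
    (fun n => div_nonneg (norm_nonneg _) (hs0 n).le) (fun n => ?_) ?_
  · have h2 : ‖e (n + p)‖ ≤ r * ‖e n‖ + ∑ i ∈ Finset.range p, ‖d (n + i)‖ := by
      have h3 := hstep n p
      have h4 := hcontr (e n) (he n)
      have h5 := norm_sub_norm_le (e (n + p)) (e n ᵥ* A ^ p)
      linarith
    calc ‖e (n + p)‖ / s (n + p)
        ≤ (r * ‖e n‖ + ∑ i ∈ Finset.range p, ‖d (n + i)‖) / s (n + p) := by
          gcongr
          exact (hs0 _).le
      _ = r * ‖e n‖ / s (n + p) + ∑ i ∈ Finset.range p, ‖d (n + i)‖ / s (n + p) := by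
          rw [add_div, Finset.sum_div]
      _ ≤ r * ‖e n‖ / s n + ∑ i ∈ Finset.range p, ‖d (n + i)‖ / s (n + i) := by
          gcongr with i hi
          · exact hs0 n
          · exact hs (Nat.le_add_right n p)
          · exact hs0 _
          · exact hs (Nat.add_le_add_left (Finset.mem_range.mp hi).le n)
      _ = _ := by rw [mul_div_assoc]
  · rw [← Finset.sum_const_zero (s := Finset.range p)]
    exact tendsto_finsetSum _ fun i _ => hd.comp (tendsto_add_atTop_nat i)

/-- The states of a network that tracks the average of the local inputs `g i` by diffusion of
their increments. -/
def diffusion (A : Matrix (Fin K) (Fin K) ℝ) (g : ℕ → Fin K → ℝ) : ℕ → Fin K → ℝ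
  | 0 => g 0
  | i + 1 => (diffusion A g i + (g (i + 1) - g i)) ᵥ* A

/-- The Perron average is conserved by combination, so the input increments telescope. -/
theorem diffusion_dotProduct {v : Fin K → ℝ} (hv : IsPerronVector A v) (g : ℕ → Fin K → ℝ)
    (i : ℕ) : diffusion A g i ⬝ᵥ v = g i ⬝ᵥ v := by
  induction i with
  | zero => rfl
  | succ i ih =>
    rw [diffusion, hv.dotProduct_vecMul, add_dotProduct, ih, sub_dotProduct]
    ring

/-- If the inputs converge at the scale `s`, every agent tracks their Perron average. -/
theorem tendsto_diffusion (h0 : ∀ l k, 0 ≤ A l k) (h1 : ∀ k, ∑ l, A l k = 1)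
    (hconn : StronglyConnected A) {v : Fin K → ℝ} (hv : IsPerronVector A v)
    {s : ℕ → ℝ} (hs : Monotone s) (hs0 : ∀ i, 0 < s i)
    (hsr : Tendsto (fun i => s (i + 1) / s i) atTop (𝓝 1)) {g : ℕ → Fin K → ℝ} {c : Fin K → ℝ}
    (hg : ∀ k, Tendsto (fun i => g i k / s i) atTop (𝓝 (c k))) (k : Fin K) :
    Tendsto (fun i => diffusion A g i k / s i) atTop (𝓝 (c ⬝ᵥ v)) := by
  have hone : ∀ a : ℝ, (fun _ => a : Fin K → ℝ) ⬝ᵥ v = a := fun a => by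
    rw [dotProduct, ← Finset.mul_sum, hv.sum_eq_one, mul_one]
  have honeA : ∀ a : ℝ, (fun _ => a : Fin K → ℝ) ᵥ* A = fun _ => a := fun a => by
    ext k
    rw [Matrix.vecMul, dotProduct, ← Finset.mul_sum, h1, mul_one]
  have havg : Tendsto (fun i => (g i ⬝ᵥ v) / s i) atTop (𝓝 (c ⬝ᵥ v)) := by
    simp only [dotProduct, Finset.sum_div, mul_div_right_comm]
    exact tendsto_finsetSum _ fun k _ => (hg k).mul_const _
  set e : ℕ → Fin K → ℝ := fun i => diffusion A g i - fun _ => g i ⬝ᵥ v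
  set d : ℕ → Fin K → ℝ := fun i => (g (i + 1) - g i) - fun _ => (g (i + 1) - g i) ⬝ᵥ v
  -- Increments are negligible at scale `s` because consecutive scales have ratio tending to 1.
  have hinc : ∀ (f : ℕ → ℝ) (a : ℝ), Tendsto (fun i => f i / s i) atTop (𝓝 a) →
      Tendsto (fun i => (f (i + 1) - f i) / s i) atTop (𝓝 0) := by
    intro f a hf
    have h2 := ((hf.comp (tendsto_add_atTop_nat 1)).mul hsr).sub hf
    rw [mul_one, sub_self] at h2
    refine h2.congr fun i => ?_
    have := (hs0 i).ne'
    have := (hs0 (i + 1)).ne'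
    simp only [Function.comp_apply]
    field_simp
  have hd : Tendsto (fun i => ‖d i‖ / s i) atTop (𝓝 0) := by
    have h2 : Tendsto (fun i => (s i)⁻¹ • d i) atTop (𝓝 0) := by
      refine tendsto_pi_nhds.mpr fun k => ?_
      have h3 := (hinc _ _ (hg k)).sub (hinc _ _ havg)
      rw [sub_zero] at h3
      refine h3.congr fun i => ?_
      simp only [d, sub_dotProduct, Pi.smul_apply, Pi.sub_apply, smul_eq_mul]
      ring
    have h4 := h2.norm
    rw [norm_zero] at h4
    refine h4.congr fun i => ?_
    rw [norm_smul, norm_inv, Real.norm_of_nonneg (hs0 i).le, div_eq_inv_mul]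
  have he := tendsto_disagreement_zero h0 h1 hconn hv hs hs0 (e := e) (d := d)
    (by rw [sub_dotProduct, hone, diffusion_dotProduct hv, sub_self])
    (fun i => by rw [sub_dotProduct, hone, sub_self])
    (fun i => by
      have h2 : e i + d i = (diffusion A g i + (g (i + 1) - g i)) - fun _ => g (i + 1) ⬝ᵥ v := by
        ext k
        simp only [e, d, sub_dotProduct, Pi.add_apply, Pi.sub_apply]
        ring
      rw [h2, Matrix.sub_vecMul, honeA]
      rfl) hd
  have hek : Tendsto (fun i => e i k / s i) atTop (𝓝 0) := by
    refine squeeze_zero_norm (fun i => ?_) he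
    rw [norm_div, Real.norm_of_nonneg (hs0 i).le]
    have := (hs0 i).le
    gcongr
    exact norm_le_pi_norm (e i) k
  have := hek.add havg
  rw [zero_add] at this
  refine this.congr fun i => ?_
  simp only [e, Pi.sub_apply]
  ring

/-- For a constant input `x`, the diffusion does not depend on the Perron vector, yet its limit is
`x ⬝ᵥ u` for each such `u`. Taking unit vectors for `x` determines all entries. -/
theorem existsUnique_perronVector (h0 : ∀ l k, 0 ≤ A l k) (h1 : ∀ k, ∑ l, A l k = 1)
    (hconn : StronglyConnected A) : ∃! v, IsPerronVector A v := by
  obtain ⟨v, hv⟩ := exists_perronVector h0 h1 hconn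
  refine ⟨v, hv, fun w hw => ?_⟩
  obtain ⟨-, c, -⟩ := id hconn
  have hlim : ∀ u, IsPerronVector A u → ∀ x : Fin K → ℝ,
      Tendsto (fun i => diffusion A (fun _ => x) i c / 1) atTop (𝓝 (x ⬝ᵥ u)) := fun u hu x =>
    tendsto_diffusion h0 h1 hconn hu (s := fun _ => 1) monotone_const (fun _ => one_pos)
      (by simp) (by simp) c
  ext k
  simpa using tendsto_nhds_unique (hlim w hw (Pi.single k 1)) (hlim v hv (Pi.single k 1))

end Network

end SocialLearning

namespace SocialLearning

open scoped Matrix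

/-! ### Log-odds form of the strategy -/

section Beliefs

variable {K H : ℕ} {X : Fin K → Type*}

/-- Bayesian updating shifts the log-odds of a hypothesis by the increment of the log-odds of the
unnormalized weights `w`, and keeps the other hypotheses proportional to their weights. -/
theorem bayesUpdate_eq {lik : Fin H → ℝ≥0} {m w w' : Fin H → ℝ} {t : Fin H} {y c : ℝ}
    (ht : (Finset.univ.erase t).Nonempty) (hlik : ∀ θ, 0 < lik θ) (hw : ∀ θ, 0 < w θ) (hc : 0 < c)
    (hw' : ∀ θ, w' θ = w θ * (lik θ / c)) (hmt : m t = Real.sigmoid y)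
    (hm : ∀ θ, θ ≠ t →
      m θ = w θ / (∑ τ ∈ Finset.univ.erase t, w τ) * (1 - Real.sigmoid y)) :
    let z := y + ((Real.log (w' t) - Real.log (∑ τ ∈ Finset.univ.erase t, w' τ))
      - (Real.log (w t) - Real.log (∑ τ ∈ Finset.univ.erase t, w τ)))
    bayesUpdate lik m t = Real.sigmoid z ∧ ∀ θ, θ ≠ t →
      bayesUpdate lik m θ
        = w' θ / (∑ τ ∈ Finset.univ.erase t, w' τ) * (1 - Real.sigmoid z) := by
  intro z
  have hlik' : ∀ θ, (0 : ℝ) < lik θ := fun θ => NNReal.coe_pos.mpr (hlik θ)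
  have hw'0 : ∀ θ, 0 < w' θ := fun θ => by
    rw [hw']
    exact mul_pos (hw θ) (div_pos (hlik' θ) hc)
  have hS : 0 < ∑ τ ∈ Finset.univ.erase t, w τ := Finset.sum_pos (fun τ _ => hw τ) ht
  have hS' : 0 < ∑ τ ∈ Finset.univ.erase t, w' τ := Finset.sum_pos (fun τ _ => hw'0 τ) ht
  -- The factor `c` is common to all hypotheses, so it will cancel in the normalized update.
  have hsum : ∑ τ, lik τ * m τ = lik t * Real.sigmoid y
      + c * (∑ τ ∈ Finset.univ.erase t, w' τ) / (∑ τ ∈ Finset.univ.erase t, w τ)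
        * (1 - Real.sigmoid y) := by
    rw [← Finset.add_sum_erase _ _ (Finset.mem_univ t), hmt, Finset.mul_sum, Finset.sum_div,
      Finset.sum_mul]
    congr 1
    refine Finset.sum_congr rfl fun θ hθ => ?_
    rw [hm θ (Finset.ne_of_mem_erase hθ), hw']
    field_simp
  set S := ∑ τ ∈ Finset.univ.erase t, w τ
  set S' := ∑ τ ∈ Finset.univ.erase t, w' τ
  have hz : Real.exp (-z) = Real.exp (-y) * (S' / w' t) * (w t / S) := by
    have h2 : -z = -y + (Real.log S' - Real.log (w' t)) + (Real.log (w t) - Real.log S) := by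
      simp only [z]
      ring
    rw [h2, Real.exp_add, Real.exp_add, Real.exp_sub, Real.exp_sub, Real.exp_log hS',
      Real.exp_log (hw'0 t), Real.exp_log (hw t), Real.exp_log hS]
  have hex := Real.exp_pos (-y)
  have hlt := hlik' t
  have hwt := hw t
  have hzt : 1 - Real.sigmoid z = Real.exp (-z) / (1 + Real.exp (-z)) := by
    rw [Real.sigmoid_def]
    have := Real.exp_pos (-z)
    field_simp
    ring
  have hyt : 1 - Real.sigmoid y = Real.exp (-y) / (1 + Real.exp (-y)) := by
    rw [Real.sigmoid_def]
    field_simp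
    ring
  constructor
  · rw [bayesUpdate, hsum, hmt, hyt, Real.sigmoid_def, Real.sigmoid_def, hz, hw' t]
    field_simp
  · intro θ hθ
    have hlθ := hlik' θ
    rw [bayesUpdate, hsum, hm θ hθ, hyt, hzt, Real.sigmoid_def, hz, hw' t, hw' θ]
    field_simp

/-- Memory-aware geometric pooling averages the log-odds of the transmitted hypothesis and keeps
the proportions among the other hypotheses. -/
theorem geometricPool_normalized {N : Fin K → Finset (Fin K)} {A : Matrix (Fin K) (Fin K) ℝ}
    (hA : IsCombinationMatrix N A) {t : Fin H} {ψ : Fin K → Fin H → ℝ} {z : Fin K → ℝ}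
    {u : Fin K → Fin H → ℝ} (hu : ∀ k θ, 0 < u k θ)
    (hu1 : ∀ k, ∑ θ ∈ Finset.univ.erase t, u k θ = 1) (hψt : ∀ k, ψ k t = Real.sigmoid (z k))
    (hψ : ∀ k θ, θ ≠ t → ψ k θ = u k θ * (1 - Real.sigmoid (z k))) (k : Fin K) :
    geometricPool N A t ψ k t / ∑ τ, geometricPool N A t ψ k τ = Real.sigmoid ((z ᵥ* A) k) ∧
    ∀ θ, θ ≠ t → geometricPool N A t ψ k θ / ∑ τ, geometricPool N A t ψ k τ
      = u k θ * (1 - Real.sigmoid ((z ᵥ* A) k)) := by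
  have hsumN : ∀ f : Fin K → ℝ, ∑ l ∈ N k, f l * A l k = ∑ l, f l * A l k := fun f =>
    Finset.sum_subset (Finset.subset_univ _) fun l _ hl => by rw [hA.eq_zero l k hl, mul_zero]
  have hcol : ∑ l ∈ N k, A l k = 1 := by
    have := hsumN fun _ => 1
    simpa [hA.col_sum] using this
  have hlt : ∀ l, 0 < 1 - Real.sigmoid (z l) := fun l => sub_pos.mpr (Real.sigmoid_lt_one _)
  -- `Q` is the factor shared by all pooled components, so normalization removes it; the transmitted
  -- one carries `exp` of the averaged log-odds because `σ(z) = exp z * (1 - σ(z))`.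
  set Q := ∏ l ∈ N k, (1 - Real.sigmoid (z l)) ^ A l k
  have hQ : 0 < Q := Finset.prod_pos fun l _ => Real.rpow_pos_of_pos (hlt l) _
  have hPt : geometricPool N A t ψ k t = Real.exp ((z ᵥ* A) k) * Q := by
    have h2 : Real.exp ((z ᵥ* A) k) = ∏ l ∈ N k, Real.exp (z l) ^ A l k := by
      simp_rw [← Real.exp_mul]
      rw [← Real.exp_sum, hsumN]
      rfl
    rw [h2, ← Finset.prod_mul_distrib]
    refine Finset.prod_congr rfl fun l _ => ?_
    rw [memoryFill, if_pos rfl, ← Real.mul_rpow (Real.exp_pos _).le (hlt l).le, hψt l]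
    congr 1
    have := Real.sigmoid_mul_rexp_neg (-(z l))
    rw [neg_neg, Real.sigmoid_neg] at this
    rw [mul_comm]
    exact this.symm
  -- Dividing by `1 - ψ k t` recovers `u k θ`, the same for every neighbor; the weights sum to one,
  -- so it leaves the product unchanged.
  have hP : ∀ θ, θ ≠ t → geometricPool N A t ψ k θ = u k θ * Q := by
    intro θ hθ
    have h2 : u k θ = ∏ l ∈ N k, u k θ ^ A l k := by
      rw [← Real.rpow_sum_of_pos (hu k θ), hcol, Real.rpow_one]
    conv_rhs => rw [h2]
    rw [← Finset.prod_mul_distrib]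
    refine Finset.prod_congr rfl fun l _ => ?_
    rw [memoryFill, if_neg hθ, ← Real.mul_rpow (hu k θ).le (hlt l).le, hψt l, hψt k, hψ k θ hθ,
      mul_div_cancel_right₀ _ (hlt k).ne']
  have hsum : ∑ τ, geometricPool N A t ψ k τ = (1 + Real.exp ((z ᵥ* A) k)) * Q := by
    rw [← Finset.add_sum_erase _ _ (Finset.mem_univ t), hPt,
      Finset.sum_congr rfl fun θ hθ => hP θ (Finset.ne_of_mem_erase hθ), ← Finset.sum_mul, hu1]
    ring
  have hsig : Real.sigmoid ((z ᵥ* A) k)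
      = Real.exp ((z ᵥ* A) k) / (1 + Real.exp ((z ᵥ* A) k)) := by
    rw [Real.sigmoid_def, Real.exp_neg]
    have := Real.exp_pos ((z ᵥ* A) k)
    field_simp
    ring
  have hexp := Real.exp_pos ((z ᵥ* A) k)
  constructor
  · rw [hPt, hsum, hsig]
    field_simp
  · intro θ hθ
    rw [hP θ hθ, hsum, hsig]
    field_simp
    ring

/-- The initial belief of an agent, reweighted by the likelihood ratios of its past
observations with respect to the true hypothesis. -/
noncomputable def posteriorWeight (L : ∀ k, Fin H → X k → ℝ≥0) (θ₀ : Fin H)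
    (μ₀ : Fin K → Fin H → ℝ) (x : ℕ → ∀ k, X k) (i : ℕ) (k : Fin K) (θ : Fin H) : ℝ :=
  μ₀ k θ * ∏ j ∈ Finset.range i, ((L k θ (x j k) : ℝ) / L k θ₀ (x j k))

/-- The log-odds of the transmitted hypothesis for an agent that does not cooperate. -/
noncomputable def localLogOdds (L : ∀ k, Fin H → X k → ℝ≥0) (θ₀ θTX : Fin H)
    (μ₀ : Fin K → Fin H → ℝ) (x : ℕ → ∀ k, X k) (i : ℕ) (k : Fin K) : ℝ :=
  Real.log (posteriorWeight L θ₀ μ₀ x i k θTX)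
    - Real.log (∑ θ ∈ Finset.univ.erase θTX, posteriorWeight L θ₀ μ₀ x i k θ)

theorem posteriorWeight_pos {L : ∀ k, Fin H → X k → ℝ≥0} {μ₀ : Fin K → Fin H → ℝ}
    {x : ℕ → ∀ k, X k} (hμ₀ : IsPositiveInitialBelief μ₀) (hx : ∀ i k θ, 0 < L k θ (x i k))
    (θ₀ : Fin H) (i : ℕ) (k : Fin K) (θ : Fin H) : 0 < posteriorWeight L θ₀ μ₀ x i k θ :=
  mul_pos (hμ₀.pos k θ) (Finset.prod_pos fun j _ =>
    div_pos (NNReal.coe_pos.mpr (hx j k θ)) (NNReal.coe_pos.mpr (hx j k θ₀)))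

/-- The log-odds of the transmitted hypothesis diffuse over the network, whereas every agent runs a
purely local Bayesian update among the other hypotheses. -/
theorem belief_eq {N : Fin K → Finset (Fin K)} {A : Matrix (Fin K) (Fin K) ℝ}
    (hA : IsCombinationMatrix N A) {L : ∀ k, Fin H → X k → ℝ≥0} {θTX : Fin H}
    {μ₀ : Fin K → Fin H → ℝ} {x : ℕ → ∀ k, X k} (θ₀ : Fin H)
    (hne : (Finset.univ.erase θTX).Nonempty)
    (hμ₀ : IsPositiveInitialBelief μ₀) (hx : ∀ i k θ, 0 < L k θ (x i k)) (i : ℕ) (k : Fin K) :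
    belief N A L θTX μ₀ x i k θTX
      = Real.sigmoid (diffusion A (localLogOdds L θ₀ θTX μ₀ x) i k) ∧
    ∀ θ, θ ≠ θTX → belief N A L θTX μ₀ x i k θ
      = posteriorWeight L θ₀ μ₀ x i k θ
        / (∑ τ ∈ Finset.univ.erase θTX, posteriorWeight L θ₀ μ₀ x i k τ)
        * (1 - Real.sigmoid (diffusion A (localLogOdds L θ₀ θTX μ₀ x) i k)) := by
  have hW := posteriorWeight_pos hμ₀ hx θ₀
  induction i generalizing k with
  | zero =>
    have h1 : ∑ τ ∈ Finset.univ.erase θTX, μ₀ k τ = 1 - μ₀ k θTX := by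
      rw [← hμ₀.sum_eq_one k, ← Finset.add_sum_erase _ _ (Finset.mem_univ θTX)]
      ring
    have h2 : 0 < 1 - μ₀ k θTX := h1 ▸ Finset.sum_pos (fun τ _ => hμ₀.pos k τ) hne
    have h3 : Real.sigmoid (diffusion A (localLogOdds L θ₀ θTX μ₀ x) 0 k) = μ₀ k θTX := by
      simp only [diffusion, localLogOdds, posteriorWeight, Finset.range_zero, Finset.prod_empty,
        mul_one]
      rw [h1, Real.sigmoid_def, neg_sub, Real.exp_sub, Real.exp_log h2,
        Real.exp_log (hμ₀.pos k θTX)]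
      have := hμ₀.pos k θTX
      field_simp
      ring
    refine ⟨h3.symm, fun θ _ => ?_⟩
    rw [h3]
    simp only [belief, posteriorWeight, Finset.range_zero, Finset.prod_empty, mul_one]
    rw [h1, div_mul_cancel₀ _ h2.ne']
  | succ i ih =>
    have hbayes := fun l => bayesUpdate_eq (lik := fun τ => L l τ (x i l))
      (m := belief N A L θTX μ₀ x i l) (w := posteriorWeight L θ₀ μ₀ x i l)
      (w' := posteriorWeight L θ₀ μ₀ x (i + 1) l) (c := L l θ₀ (x i l))
      hne (hx i l) (hW i l) (NNReal.coe_pos.mpr (hx i l θ₀))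
      (fun θ => by rw [posteriorWeight, Finset.prod_range_succ, ← mul_assoc]; rfl)
      (ih l).1 (ih l).2
    have hS : ∀ l, 0 < ∑ τ ∈ Finset.univ.erase θTX, posteriorWeight L θ₀ μ₀ x (i + 1) l τ :=
      fun l => Finset.sum_pos (fun τ _ => hW (i + 1) l τ) hne
    exact geometricPool_normalized hA
      (u := fun l θ => posteriorWeight L θ₀ μ₀ x (i + 1) l θ
        / ∑ τ ∈ Finset.univ.erase θTX, posteriorWeight L θ₀ μ₀ x (i + 1) l τ)
      (fun l θ => div_pos (hW (i + 1) l θ) (hS l))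
      (fun l => by rw [← Finset.sum_div, div_self (hS l).ne'])
      (fun l => (hbayes l).1) (fun l => (hbayes l).2) k

/-- Without alternative hypotheses, the belief in the only hypothesis is one. -/
theorem belief_eq_one {N : Fin K → Finset (Fin K)} {A : Matrix (Fin K) (Fin K) ℝ}
    {L : ∀ k, Fin H → X k → ℝ≥0} {θTX : Fin H}
    {μ₀ : Fin K → Fin H → ℝ} {x : ℕ → ∀ k, X k} (huniq : ∀ θ, θ = θTX)
    (hμ₀ : IsPositiveInitialBelief μ₀) (hx : ∀ i k θ, 0 < L k θ (x i k)) (i : ℕ) (k : Fin K) :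
    belief N A L θTX μ₀ x i k θTX = 1 := by
  have hsum : ∀ f : Fin H → ℝ, ∑ θ, f θ = f θTX := fun f =>
    Finset.sum_eq_single_of_mem θTX (Finset.mem_univ _) fun θ _ h => absurd (huniq θ) h
  induction i generalizing k with
  | zero => rw [belief, ← hμ₀.sum_eq_one k, hsum]
  | succ i ih =>
    have hψ : ∀ l, bayesUpdate (fun τ => L l τ (x i l)) (belief N A L θTX μ₀ x i l) θTX = 1 := by
      intro l
      have := (NNReal.coe_pos.mpr (hx i l θTX)).ne'
      rw [bayesUpdate, hsum, ih, mul_one, div_self this]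
    simp only [belief, step]
    rw [hsum]
    simp [geometricPool, memoryFill, hψ]

end Beliefs

end SocialLearning

namespace SocialLearning

open scoped Matrix

/-! ### Limits along a fixed sequence of observations -/

section DeterministicLimits

/-- The log-sum-exp lies between the maximum and the maximum plus `log F.card`, which is negligible
at a diverging scale. -/
theorem tendsto_log_sum_exp_div {ι : Type*} {F : Finset ι} (hF : F.Nonempty) {f : ℕ → ι → ℝ}
    {a : ι → ℝ} {s : ℕ → ℝ} (hs0 : ∀ i, 0 < s i) (hs : Tendsto s atTop atTop)
    (hf : ∀ θ ∈ F, Tendsto (fun i => f i θ / s i) atTop (𝓝 (a θ))) :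
    Tendsto (fun i => Real.log (∑ θ ∈ F, Real.exp (f i θ)) / s i) atTop (𝓝 (F.sup' hF a)) := by
  have hlow : Tendsto (fun i => F.sup' hF fun θ => f i θ / s i) atTop (𝓝 (F.sup' hF a)) :=
    Tendsto.finset_sup'_nhds_apply hF hf
  have hupp := hlow.add (tendsto_const_nhds (x := Real.log F.card) |>.div_atTop hs)
  rw [add_zero] at hupp
  have hpos : ∀ i, 0 < ∑ θ ∈ F, Real.exp (f i θ) := fun i =>
    Finset.sum_pos (fun θ _ => Real.exp_pos _) hF
  refine tendsto_of_tendsto_of_tendsto_of_le_of_le hlow hupp (fun i => ?_) fun i => ?_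
  · refine Finset.sup'_le hF _ fun θ hθ => div_le_div_of_nonneg_right ?_ (hs0 i).le
    rw [Real.le_log_iff_exp_le (hpos i)]
    exact Finset.single_le_sum (f := fun θ => Real.exp (f i θ)) (fun θ _ => (Real.exp_pos _).le) hθ
  · simp only
    set m := F.sup' hF fun θ => f i θ / s i
    rw [div_le_iff₀ (hs0 i), add_mul, div_mul_cancel₀ _ (hs0 i).ne',
      Real.log_le_iff_le_exp (hpos i), Real.exp_add,
      Real.exp_log (Nat.cast_pos.mpr hF.card_pos), mul_comm, ← nsmul_eq_mul]
    refine Finset.sum_le_card_nsmul _ _ _ fun θ hθ => Real.exp_le_exp.mpr ?_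
    rw [← div_le_iff₀ (hs0 i)]
    exact Finset.le_sup' (fun θ => f i θ / s i) hθ

theorem tendsto_natCast_add_one : Tendsto (fun i : ℕ => (i : ℝ) + 1) atTop atTop :=
  tendsto_atTop_add_const_right _ _ tendsto_natCast_atTop_atTop

variable {K H : ℕ} {X : Fin K → Type*}
  {N : Fin K → Finset (Fin K)} {A : Matrix (Fin K) (Fin K) ℝ}
  {L : ∀ k, Fin H → X k → ℝ≥0} {θ₀ θTX : Fin H} {μ₀ : Fin K → Fin H → ℝ} {x : ℕ → ∀ k, X k}
  {d : Fin K → Fin H → ℝ}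

theorem tendsto_log_posteriorWeight_div (hμ₀ : IsPositiveInitialBelief μ₀)
    (hx : ∀ i k θ, 0 < L k θ (x i k)) {k : Fin K} {θ : Fin H}
    (hd : Tendsto (fun n : ℕ => (∑ j ∈ Finset.range n,
      Real.log ((L k θ₀ (x j k) : ℝ) / L k θ (x j k))) / n) atTop (𝓝 (d k θ))) :
    Tendsto (fun i : ℕ => Real.log (posteriorWeight L θ₀ μ₀ x i k θ) / ((i : ℝ) + 1)) atTop
      (𝓝 (-d k θ)) := by
  have h1 : Tendsto (fun n : ℕ => (n : ℝ) / (n + 1)) atTop (𝓝 1) :=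
    tendsto_natCast_div_add_atTop 1
  have h2 := ((tendsto_const_nhds (x := Real.log (μ₀ k θ))).div_atTop
    tendsto_natCast_add_one).sub (hd.mul h1)
  rw [mul_one, zero_sub] at h2
  refine h2.congr fun n => ?_
  have hx' : ∀ j θ, (0 : ℝ) < L k θ (x j k) := fun j θ => NNReal.coe_pos.mpr (hx j k θ)
  have h3 : Real.log (posteriorWeight L θ₀ μ₀ x n k θ) = Real.log (μ₀ k θ)
      - ∑ j ∈ Finset.range n, Real.log ((L k θ₀ (x j k) : ℝ) / L k θ (x j k)) := by
    rw [posteriorWeight, Real.log_mul (hμ₀.pos k θ).ne'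
      (Finset.prod_pos fun j _ => div_pos (hx' j θ) (hx' j θ₀)).ne',
      Real.log_prod fun j _ => (div_pos (hx' j θ) (hx' j θ₀)).ne', sub_eq_add_neg,
      ← Finset.sum_neg_distrib]
    congr 1
    refine Finset.sum_congr rfl fun j _ => ?_
    rw [← Real.log_inv, inv_div]
  rw [h3]
  -- At `n = 0` the sum is empty and the quotient by zero is zero, so the identity persists.
  rcases Nat.eq_zero_or_pos n with rfl | hn
  · simp
  · have : (0 : ℝ) < n := Nat.cast_pos.mpr hn
    field_simp

theorem tendsto_localLogOdds_div (hne : (Finset.univ.erase θTX).Nonempty)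
    (hμ₀ : IsPositiveInitialBelief μ₀) (hx : ∀ i k θ, 0 < L k θ (x i k))
    (hd : ∀ k θ, Tendsto (fun n : ℕ => (∑ j ∈ Finset.range n,
      Real.log ((L k θ₀ (x j k) : ℝ) / L k θ (x j k))) / n) atTop (𝓝 (d k θ))) (k : Fin K) :
    Tendsto (fun i : ℕ => localLogOdds L θ₀ θTX μ₀ x i k / ((i : ℝ) + 1)) atTop
      (𝓝 (-d k θTX - (Finset.univ.erase θTX).sup' hne fun θ => -d k θ)) := by
  have h1 := tendsto_log_sum_exp_div hne
    (f := fun i θ => Real.log (posteriorWeight L θ₀ μ₀ x i k θ))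
    (fun i : ℕ => by positivity) tendsto_natCast_add_one
    fun θ _ => tendsto_log_posteriorWeight_div hμ₀ hx (hd k θ)
  simp_rw [Real.exp_log (posteriorWeight_pos hμ₀ hx θ₀ _ _ _)] at h1
  refine ((tendsto_log_posteriorWeight_div hμ₀ hx (hd k θTX)).sub h1).congr fun i => ?_
  rw [localLogOdds, sub_div]

theorem tendsto_networkLogOdds_div (hA : IsCombinationMatrix N A) (hconn : StronglyConnected A)
    {v : Fin K → ℝ} (hv : IsPerronVector A v) (hne : (Finset.univ.erase θTX).Nonempty)
    (hμ₀ : IsPositiveInitialBelief μ₀) (hx : ∀ i k θ, 0 < L k θ (x i k))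
    (hd : ∀ k θ, Tendsto (fun n : ℕ => (∑ j ∈ Finset.range n,
      Real.log ((L k θ₀ (x j k) : ℝ) / L k θ (x j k))) / n) atTop (𝓝 (d k θ))) (k : Fin K) :
    Tendsto (fun i : ℕ => diffusion A (localLogOdds L θ₀ θTX μ₀ x) i k / ((i : ℝ) + 1)) atTop
      (𝓝 (∑ l, (-d l θTX - (Finset.univ.erase θTX).sup' hne fun θ => -d l θ) * v l)) := by
  have hs : Tendsto (fun i : ℕ => (((i + 1 : ℕ) : ℝ) + 1) / ((i : ℝ) + 1)) atTop (𝓝 1) := by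
    have h1 := (tendsto_const_nhds (x := (1 : ℝ))).add
      ((tendsto_const_nhds (x := (1 : ℝ))).div_atTop tendsto_natCast_add_one)
    rw [add_zero] at h1
    refine h1.congr fun i => ?_
    push_cast
    field_simp
  exact tendsto_diffusion hA.nonneg hA.col_sum hconn hv (s := fun i : ℕ => (i : ℝ) + 1)
    (fun i j h => by simpa using h) (fun i => by positivity) hs
    (tendsto_localLogOdds_div hne hμ₀ hx hd) k

/-- The truth is among the alternatives and has rate 0, so the largest alternative rate is
nonnegative. No agent contributes positively, and one that distinguishes the transmitted hypothesis
contributes negatively. -/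
theorem tendsto_belief_of_false (hA : IsCombinationMatrix N A) (hconn : StronglyConnected A)
    {v : Fin K → ℝ} (hv : IsPerronVector A v)
    (hμ₀ : IsPositiveInitialBelief μ₀) (hx : ∀ i k θ, 0 < L k θ (x i k))
    (hd : ∀ k θ, Tendsto (fun n : ℕ => (∑ j ∈ Finset.range n,
      Real.log ((L k θ₀ (x j k) : ℝ) / L k θ (x j k))) / n) atTop (𝓝 (d k θ)))
    (hd0 : ∀ k θ, 0 ≤ d k θ) (hdθ₀ : ∀ k, d k θ₀ = 0) (hTX : θTX ≠ θ₀)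
    (hident : ∃ k, 0 < d k θTX) (k : Fin K) :
    Tendsto (fun i => belief N A L θTX μ₀ x i k θTX) atTop (𝓝 0) := by
  have hmem : θ₀ ∈ Finset.univ.erase θTX := Finset.mem_erase.mpr ⟨hTX.symm, Finset.mem_univ _⟩
  have hne : (Finset.univ.erase θTX).Nonempty := ⟨θ₀, hmem⟩
  have hsup : ∀ l, (0 : ℝ) ≤ (Finset.univ.erase θTX).sup' hne fun θ => -d l θ := fun l => by
    have := Finset.le_sup' (fun θ => -d l θ) hmem
    rwa [hdθ₀, neg_zero] at this
  have hneg : ∑ l, (-d l θTX - (Finset.univ.erase θTX).sup' hne fun θ => -d l θ) * v l < 0 := by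
    obtain ⟨l, hl⟩ := hident
    refine Finset.sum_neg' (fun j _ => ?_) ⟨l, Finset.mem_univ l, ?_⟩
    · exact mul_nonpos_of_nonpos_of_nonneg (by linarith [hd0 j θTX, hsup j]) (hv.pos j).le
    · exact mul_neg_of_neg_of_pos (by linarith [hsup l]) (hv.pos l)
  have hy : Tendsto (diffusion A (localLogOdds L θ₀ θTX μ₀ x) · k) atTop atBot :=
    ((tendsto_networkLogOdds_div hA hconn hv hne hμ₀ hx hd k).neg_mul_atTop hneg
      tendsto_natCast_add_one).congr fun i => div_mul_cancel₀ _ (by positivity)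
  exact (Real.tendsto_sigmoid_atBot.comp hy).congr fun i =>
    ((belief_eq hA θ₀ hne hμ₀ hx i k).1).symm

/-- All alternatives decay exponentially at the unconfused agent. Its positive rate, weighted by a
positive Perron entry, drives the whole network. -/
theorem tendsto_belief_of_true_of_unconfused (hA : IsCombinationMatrix N A)
    (hconn : StronglyConnected A) {v : Fin K → ℝ} (hv : IsPerronVector A v)
    (hμ₀ : IsPositiveInitialBelief μ₀) (hx : ∀ i k θ, 0 < L k θ (x i k))
    (hd : ∀ k θ, Tendsto (fun n : ℕ => (∑ j ∈ Finset.range n,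
      Real.log ((L k θ₀ (x j k) : ℝ) / L k θ (x j k))) / n) atTop (𝓝 (d k θ)))
    (hd0 : ∀ k θ, 0 ≤ d k θ) (hdθ₀ : ∀ k, d k θ₀ = 0)
    (hne : (Finset.univ.erase θ₀).Nonempty)
    (hident : ∃ k, ∀ θ, θ ≠ θ₀ → 0 < d k θ) (k : Fin K) :
    Tendsto (fun i => belief N A L θ₀ μ₀ x i k θ₀) atTop (𝓝 1) := by
  have hpos : 0 < ∑ l, (-d l θ₀ - (Finset.univ.erase θ₀).sup' hne fun θ => -d l θ) * v l := by
    obtain ⟨l, hl⟩ := hident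
    refine Finset.sum_pos' (fun j _ => mul_nonneg ?_ (hv.pos j).le)
      ⟨l, Finset.mem_univ l, mul_pos ?_ (hv.pos l)⟩
    · rw [hdθ₀, neg_zero, zero_sub, neg_nonneg]
      exact Finset.sup'_le hne _ fun θ _ => neg_nonpos.mpr (hd0 j θ)
    · rw [hdθ₀, neg_zero, zero_sub, neg_pos, Finset.sup'_lt_iff]
      exact fun θ hθ => neg_neg_of_pos (hl θ (Finset.ne_of_mem_erase hθ))
  have hy : Tendsto (diffusion A (localLogOdds L θ₀ θ₀ μ₀ x) · k) atTop atTop :=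
    ((tendsto_networkLogOdds_div hA hconn hv hne hμ₀ hx hd k).pos_mul_atTop hpos
      tendsto_natCast_add_one).congr fun i => div_mul_cancel₀ _ (by positivity)
  exact (Real.tendsto_sigmoid_atTop.comp hy).congr fun i =>
    ((belief_eq hA θ₀ hne hμ₀ hx i k).1).symm

/-- Rates vanish here, so the local log-odds themselves converge. The limit keeps a memory of the
priors, through the weights of the confused hypotheses. -/
theorem tendsto_belief_of_true_of_confused (hA : IsCombinationMatrix N A)
    (hconn : StronglyConnected A) {v : Fin K → ℝ} (hv : IsPerronVector A v)
    (hμ₀ : IsPositiveInitialBelief μ₀) (hx : ∀ i k θ, 0 < L k θ (x i k))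
    (hd : ∀ k θ, Tendsto (fun n : ℕ => (∑ j ∈ Finset.range n,
      Real.log ((L k θ₀ (x j k) : ℝ) / L k θ (x j k))) / n) atTop (𝓝 (d k θ)))
    {I : Fin K → Finset (Fin H)} (hI : ∀ k, (I k).Nonempty) (hIθ₀ : ∀ k, θ₀ ∉ I k)
    (hIeq : ∀ k, ∀ θ ∈ I k, ∀ i, L k θ (x i k) = L k θ₀ (x i k))
    (hdpos : ∀ k θ, θ ≠ θ₀ → θ ∉ I k → 0 < d k θ) (k : Fin K) :
    Tendsto (fun i => belief N A L θ₀ μ₀ x i k θ₀) atTop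
      (𝓝 (1 / (1 + ∏ l, ((∑ θ ∈ I l, μ₀ l θ) / μ₀ l θ₀) ^ v l))) := by
  have hne : (Finset.univ.erase θ₀).Nonempty := by
    obtain ⟨θ, hθ⟩ := hI k
    exact ⟨θ, Finset.mem_erase.mpr ⟨fun h => hIθ₀ k (h ▸ hθ), Finset.mem_univ _⟩⟩
  have hconst : ∀ l θ i, (∀ j, L l θ (x j l) = L l θ₀ (x j l)) →
      posteriorWeight L θ₀ μ₀ x i l θ = μ₀ l θ := fun l θ i h => by
    rw [posteriorWeight, Finset.prod_eq_one fun j _ => ?_, mul_one]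
    rw [h j, div_self (NNReal.coe_pos.mpr (hx j l θ₀)).ne']
  have hIpos : ∀ l, 0 < ∑ θ ∈ I l, μ₀ l θ := fun l =>
    Finset.sum_pos (fun θ _ => hμ₀.pos l θ) (hI l)
  have hsum : ∀ l, Tendsto (fun i => ∑ θ ∈ Finset.univ.erase θ₀, posteriorWeight L θ₀ μ₀ x i l θ)
      atTop (𝓝 (∑ θ ∈ I l, μ₀ l θ)) := by
    intro l
    have hsub : I l ⊆ Finset.univ.erase θ₀ := fun θ hθ =>
      Finset.mem_erase.mpr ⟨fun h => hIθ₀ l (h ▸ hθ), Finset.mem_univ _⟩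
    have hEq : ∑ θ ∈ I l, μ₀ l θ = ∑ θ ∈ Finset.univ.erase θ₀, if θ ∈ I l then μ₀ l θ else 0 := by
      rw [← Finset.sum_subset hsub fun θ _ hθ => if_neg hθ]
      exact Finset.sum_congr rfl fun θ hθ => (if_pos hθ).symm
    rw [hEq]
    refine tendsto_finsetSum _ fun θ hθ => ?_
    split_ifs with hθI
    · exact tendsto_const_nhds.congr fun i => (hconst l θ i (hIeq l θ hθI)).symm
    · have h1 : Tendsto (fun i => Real.log (posteriorWeight L θ₀ μ₀ x i l θ)) atTop atBot :=
        ((tendsto_log_posteriorWeight_div hμ₀ hx (hd l θ)).neg_mul_atTop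
          (neg_neg_of_pos (hdpos l θ (Finset.ne_of_mem_erase hθ) hθI))
          tendsto_natCast_add_one).congr fun i => div_mul_cancel₀ _ (by positivity)
      exact (Real.tendsto_exp_atBot.comp h1).congr fun i =>
        Real.exp_log (posteriorWeight_pos hμ₀ hx θ₀ i l θ)
  have hg : ∀ l, Tendsto (fun i => localLogOdds L θ₀ θ₀ μ₀ x i l / 1) atTop
      (𝓝 (-Real.log ((∑ θ ∈ I l, μ₀ l θ) / μ₀ l θ₀))) := by
    intro l
    rw [Real.log_div (hIpos l).ne' (hμ₀.pos l θ₀).ne', neg_sub]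
    refine (tendsto_const_nhds.sub ((hsum l).log (hIpos l).ne')).congr fun i => ?_
    rw [div_one, localLogOdds, hconst l θ₀ i fun _ => rfl]
  have hy := tendsto_diffusion hA.nonneg hA.col_sum hconn hv (s := fun _ => 1) monotone_const
    (fun _ => one_pos) (by simp) hg k
  have hlim : Real.sigmoid ((fun l => -Real.log ((∑ θ ∈ I l, μ₀ l θ) / μ₀ l θ₀)) ⬝ᵥ v)
      = 1 / (1 + ∏ l, ((∑ θ ∈ I l, μ₀ l θ) / μ₀ l θ₀) ^ v l) := by
    rw [Real.sigmoid_def, one_div, dotProduct, ← Finset.sum_neg_distrib, Real.exp_sum]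
    congr 2
    refine Finset.prod_congr rfl fun l _ => ?_
    rw [Real.rpow_def_of_pos (div_pos (hIpos l) (hμ₀.pos l θ₀)), neg_mul, neg_neg]
  rw [← hlim]
  refine ((continuous_sigmoid.tendsto _).comp hy).congr fun i => ?_
  rw [(belief_eq hA θ₀ hne hμ₀ hx i k).1, Function.comp_apply, div_one]

end DeterministicLimits

end SocialLearning

namespace SocialLearning

/-! ### Likelihood ratios of the random observations -/

section Observations

variable {K H : ℕ} {X : Fin K → Type*} [∀ k, MeasurableSpace (X k)]
  {ν : ∀ k, Measure (X k)} {L : ∀ k, Fin H → X k → ℝ≥0}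

theorem isProbabilityMeasure_law (hL : IsLikelihoodModel ν L) (k : Fin K) (θ : Fin H) :
    IsProbabilityMeasure (law ν L k θ) :=
  ⟨by rw [law, withDensity_apply _ MeasurableSet.univ, setLIntegral_univ, hL.lintegral_eq_one]⟩

theorem law_ac (hKL : FiniteDivergences ν L) (k : Fin K) (θ θ' : Fin H) :
    law ν L k θ ≪ law ν L k θ' :=
  (InformationTheory.klDiv_ne_top_iff.mp (hKL k θ θ').ne).1

/-- A density is positive almost everywhere under its own law, and finite divergence transfers this
to the true law by absolute continuity. -/
theorem ae_likelihood_pos (hL : IsLikelihoodModel ν L) (hKL : FiniteDivergences ν L) (k : Fin K)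
    (θ₀ θ : Fin H) : ∀ᵐ x ∂law ν L k θ₀, 0 < L k θ x := by
  suffices h : ∀ᵐ x ∂law ν L k θ, 0 < L k θ x from (law_ac hKL k θ₀ θ).ae_le h
  rw [law, ae_withDensity_iff (hL.measurable k θ).coe_nnreal_ennreal]
  exact Eventually.of_forall fun x hx => pos_iff_ne_zero.mpr (by exact_mod_cast hx)

/-- The chain rule for densities with respect to `ν k`, divided by the density of `θ`, which is
almost surely positive. -/
theorem llr_law_ae_eq [∀ k, SigmaFinite (ν k)] (hL : IsLikelihoodModel ν L)
    (hKL : FiniteDivergences ν L) (k : Fin K) (θ₀ θ : Fin H) :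
    llr (law ν L k θ₀) (law ν L k θ)
      =ᵐ[law ν L k θ₀] fun x => Real.log ((L k θ₀ x : ℝ) / L k θ x) := by
  have := isProbabilityMeasure_law hL k
  have hchain := Measure.rnDeriv_mul_rnDeriv (κ := ν k) (law_ac hKL k θ₀ θ)
  have h1 : ∀ τ, (law ν L k τ).rnDeriv (ν k) =ᵐ[ν k] fun x => (L k τ x : ℝ≥0∞) := fun τ =>
    Measure.rnDeriv_withDensity (ν k) (hL.measurable k τ).coe_nnreal_ennreal
  have h2 : (fun x => (law ν L k θ₀).rnDeriv (law ν L k θ) x * L k θ x)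
      =ᵐ[ν k] fun x => (L k θ₀ x : ℝ≥0∞) := by
    filter_upwards [hchain, h1 θ₀, h1 θ] with x hx hx₀ hx₁
    rw [← hx₀, ← hx, Pi.mul_apply, hx₁]
  filter_upwards [(withDensity_absolutelyContinuous (ν k) _).ae_le h2,
    ae_likelihood_pos hL hKL k θ₀ θ] with x hx hpos
  have h3 := congrArg ENNReal.toReal hx
  rw [ENNReal.toReal_mul, ENNReal.coe_toReal, ENNReal.coe_toReal] at h3
  rw [llr, ← h3, mul_div_cancel_right₀ _ (NNReal.coe_pos.mpr hpos).ne']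

theorem ae_eq_of_divergence_eq_zero [∀ k, SigmaFinite (ν k)] (hL : IsLikelihoodModel ν L)
    {k : Fin K} {θ₀ θ : Fin H} (h : divergence ν L k θ₀ θ = 0) :
    ∀ᵐ x ∂law ν L k θ₀, L k θ x = L k θ₀ x := by
  have := isProbabilityMeasure_law hL k
  rw [divergence, InformationTheory.klDiv_eq_zero_iff, law, law,
    withDensity_eq_iff_of_sigmaFinite (hL.measurable k θ₀).coe_nnreal_ennreal.aemeasurable
      (hL.measurable k θ).coe_nnreal_ennreal.aemeasurable] at h
  refine (withDensity_absolutelyContinuous (ν k) _).ae_le ?_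
  filter_upwards [h] with x hx
  exact_mod_cast hx.symm

variable {Ω : Type*} [MeasurableSpace Ω] {P : Measure Ω} {θ₀ : Fin H} {ξ : ∀ k, ℕ → Ω → X k}

theorem IsObservationProcess.ae_of_ae_law (hξ : IsObservationProcess P ν L θ₀ ξ) {k : Fin K}
    {p : X k → Prop} (hp : ∀ᵐ x ∂law ν L k θ₀, p x) (i : ℕ) : ∀ᵐ ω ∂P, p (ξ k i ω) := by
  rw [← hξ.map_eq k i] at hp
  exact ae_of_ae_map (hξ.measurable k i).aemeasurable hp

/-- The average log-likelihood ratios converge to the divergences. -/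
theorem IsObservationProcess.ae_tendsto_average_log_ratio [∀ k, SigmaFinite (ν k)]
    (hξ : IsObservationProcess P ν L θ₀ ξ) (hL : IsLikelihoodModel ν L)
    (hKL : FiniteDivergences ν L) (k : Fin K) (θ : Fin H) :
    ∀ᵐ ω ∂P, Tendsto (fun n : ℕ => (∑ j ∈ Finset.range n,
      Real.log ((L k θ₀ (ξ k j ω) : ℝ) / L k θ (ξ k j ω))) / n) atTop
      (𝓝 (divergence ν L k θ₀ θ).toReal) := by
  have := isProbabilityMeasure_law hL k
  set f : X k → ℝ := fun x => Real.log ((L k θ₀ x : ℝ) / L k θ x) with hf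
  have hfm : Measurable f :=
    ((hL.measurable k θ₀).coe_nnreal_real.div (hL.measurable k θ).coe_nnreal_real).log
  have hllr := llr_law_ae_eq hL hKL k θ₀ θ
  have hint : Integrable f (law ν L k θ₀) :=
    (InformationTheory.klDiv_ne_top_iff.mp (hKL k θ₀ θ).ne).2.congr hllr
  have hmean : ∫ ω, f (ξ k 0 ω) ∂P = (divergence ν L k θ₀ θ).toReal := by
    rw [divergence, InformationTheory.toReal_klDiv_of_measure_eq (law_ac hKL k θ₀ θ)
      (by rw [measure_univ, measure_univ]), integral_congr_ae hllr, ← hξ.map_eq k 0,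
      integral_map (hξ.measurable k 0).aemeasurable hfm.aestronglyMeasurable]
  have hfk : Measurable fun y : ∀ l, X l => f (y k) := hfm.comp (measurable_pi_apply k)
  have hslln := strong_law_ae_real (μ := P) (fun i ω => f (ξ k i ω))
    (by
      rw [← hξ.map_eq k 0] at hint
      exact hint.comp_measurable (hξ.measurable k 0))
    (fun i j hij => (hξ.indep.indepFun hij).comp hfk hfk)
    (fun i => IdentDistrib.comp ⟨(hξ.measurable k i).aemeasurable,
      (hξ.measurable k 0).aemeasurable, by rw [hξ.map_eq, hξ.map_eq]⟩ hfm)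
  rw [hmean] at hslln
  exact hslln

end Observations

/-! ### Bounds on the confusion ratio -/

section ConfusionRatio

variable {K H : ℕ} {X : Fin K → Type*} [∀ k, MeasurableSpace (X k)]
  {ν : ∀ k, Measure (X k)} {L : ∀ k, Fin H → X k → ℝ≥0} {θ₀ : Fin H} {μ₀ : Fin K → Fin H → ℝ}
  {v : Fin K → ℝ}

theorem confusionRatio_nonneg (hμ₀ : IsPositiveInitialBelief μ₀) (k : Fin K) :
    0 ≤ confusionRatio ν L θ₀ μ₀ k :=
  div_nonneg (Finset.sum_nonneg fun θ _ => (hμ₀.pos k θ).le) (hμ₀.pos k θ₀).le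

theorem networkConfusionRatio_nonneg (hμ₀ : IsPositiveInitialBelief μ₀) :
    0 ≤ networkConfusionRatio ν L θ₀ μ₀ v :=
  Finset.prod_nonneg fun k _ => Real.rpow_nonneg (confusionRatio_nonneg hμ₀ k) _

theorem networkConfusionRatio_eq_zero (hv : ∀ k, 0 < v k) {k : Fin K}
    (hk : indistinguishable ν L θ₀ k = ∅) : networkConfusionRatio ν L θ₀ μ₀ v = 0 := by
  refine Finset.prod_eq_zero (Finset.mem_univ k) ?_
  rw [confusionRatio, hk, Finset.sum_empty, zero_div, Real.zero_rpow (hv k).ne']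

theorem minInitialBelief_le (μ₀ : Fin K → Fin H → ℝ) (k : Fin K) (θ : Fin H) :
    minInitialBelief μ₀ ≤ μ₀ k θ :=
  ciInf_le (Set.finite_range fun q : Fin K × Fin H => μ₀ q.1 q.2).bddBelow (k, θ)

/-- With `m` the minimal belief, each local ratio is at most `(1 - μ₀ k θ₀) / μ₀ k θ₀ ≤ (1 - m) /
m`. A geometric mean with weights summing to one obeys the same bound, which rearranges to the
claim. -/
theorem minInitialBelief_le_one_div (hμ₀ : IsPositiveInitialBelief μ₀) (hv : ∀ k, 0 < v k)
    (hv1 : ∑ k, v k = 1) (hm : 0 < minInitialBelief μ₀) :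
    minInitialBelief μ₀ ≤ 1 / (1 + networkConfusionRatio ν L θ₀ μ₀ v) := by
  set m := minInitialBelief μ₀
  have hratio : ∀ k, confusionRatio ν L θ₀ μ₀ k ≤ (1 - m) / m := by
    intro k
    have hmk : m ≤ μ₀ k θ₀ := minInitialBelief_le μ₀ k θ₀
    have hsub : indistinguishable ν L θ₀ k ⊆ Finset.univ.erase θ₀ := fun θ hθ =>
      Finset.mem_erase.mpr ⟨(Finset.mem_filter.mp hθ).2.1, Finset.mem_univ _⟩
    have hle : ∑ θ ∈ indistinguishable ν L θ₀ k, μ₀ k θ ≤ 1 - μ₀ k θ₀ := by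
      rw [← hμ₀.sum_eq_one k, ← Finset.add_sum_erase _ _ (Finset.mem_univ θ₀), add_sub_cancel_left]
      exact Finset.sum_le_sum_of_subset_of_nonneg hsub fun θ _ _ => (hμ₀.pos k θ).le
    rw [confusionRatio, div_le_div_iff₀ (hμ₀.pos k θ₀) hm]
    nlinarith
  have hK : ∃ k : Fin K, k ∈ Finset.univ := by
    by_contra! h
    rw [Finset.sum_eq_zero fun k _ => absurd (Finset.mem_univ k) (h k)] at hv1
    exact zero_ne_one hv1
  obtain ⟨c, -⟩ := hK
  have hR : 0 ≤ (1 - m) / m := (confusionRatio_nonneg hμ₀ c).trans (hratio c)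
  have hρ : networkConfusionRatio ν L θ₀ μ₀ v ≤ (1 - m) / m := by
    calc networkConfusionRatio ν L θ₀ μ₀ v ≤ ∏ k, ((1 - m) / m) ^ v k :=
          Finset.prod_le_prod (fun k _ => Real.rpow_nonneg (confusionRatio_nonneg hμ₀ k) _)
            fun k _ => Real.rpow_le_rpow (confusionRatio_nonneg hμ₀ k) (hratio k) (hv k).le
      _ = (1 - m) / m := by
          rw [← Real.rpow_sum_of_nonneg hR fun k _ => (hv k).le, hv1, Real.rpow_one]
  have hρ0 : 0 ≤ networkConfusionRatio ν L θ₀ μ₀ v := networkConfusionRatio_nonneg hμ₀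
  rw [le_div_iff₀ hm] at hρ
  rw [le_div_iff₀ (by linarith)]
  linarith

end ConfusionRatio

/-- The events "in `S j` from time `i` on" increase to a set of full measure. Continuity from below
needs no measurability of `S`. -/
theorem tendsto_measure_one_of_ae_eventually {Ω : Type*} [MeasurableSpace Ω] {P : Measure Ω}
    [IsProbabilityMeasure P] {S : ℕ → Set Ω} (h : ∀ᵐ ω ∂P, ∀ᶠ i in atTop, ω ∈ S i) :
    Tendsto (fun i => P (S i)) atTop (𝓝 1) := by
  set T : ℕ → Set Ω := fun i => {ω | ∀ j, i ≤ j → ω ∈ S j} with hT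
  have hmono : Monotone T := fun a b hab ω hω j hj => hω j (hab.trans hj)
  have hunion : P (⋃ i, T i) = 1 := by
    rw [← measure_univ (μ := P)]
    refine measure_congr (eventuallyEq_univ.mpr ?_)
    filter_upwards [h] with ω hω
    obtain ⟨i, hi⟩ := eventually_atTop.mp hω
    exact Set.mem_iUnion.mpr ⟨i, hi⟩
  have hlim := tendsto_measure_iUnion_atTop (μ := P) hmono
  rw [hunion] at hlim
  exact tendsto_of_tendsto_of_tendsto_of_le_of_le hlim tendsto_const_nhds
    (fun i => measure_mono fun ω hω => hω i le_rfl) fun i => prob_le_one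

end SocialLearning

/-! ### Assembly of the main result -/

theorem corollary2 {K H : ℕ}
    -- network
    (N : Fin K → Finset (Fin K)) (A : Matrix (Fin K) (Fin K) ℝ)
    (hA : SocialLearning.IsCombinationMatrix N A)
    -- likelihoods
    {X : Fin K → Type*} [∀ k, MeasurableSpace (X k)]
    (ν : ∀ k, Measure (X k)) [∀ k, SigmaFinite (ν k)]
    (L : ∀ k, Fin H → X k → ℝ≥0) (hL : SocialLearning.IsLikelihoodModel ν L)
    -- true and transmitted hypotheses, observations
    (θ₀ θTX : Fin H)
    {Ω : Type*} [MeasurableSpace Ω] (P : Measure Ω) [IsProbabilityMeasure P]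
    (ξ : ∀ k, ℕ → Ω → X k) (hξ : SocialLearning.IsObservationProcess P ν L θ₀ ξ)
    -- initial beliefs
    (μ₀ : Fin K → Fin H → ℝ)
    -- assumptions
    (hconn : SocialLearning.StronglyConnected A)
    (hKL : SocialLearning.FiniteDivergences ν L)
    (hμ₀ : SocialLearning.IsPositiveInitialBelief μ₀)
    (hident : SocialLearning.GloballyIdentifiable ν L θ₀)
    (hconv : SocialLearning.NotConvexCombination ν L θ₀) :
    (∃! v : Fin K → ℝ, SocialLearning.IsPerronVector A v) ∧
    ∀ v : Fin K → ℝ, SocialLearning.IsPerronVector A v →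
      let ρ : ℝ := SocialLearning.networkConfusionRatio ν L θ₀ μ₀ v
      let μ : ℕ → Fin K → Fin H → Ω → ℝ := fun i k θ ω =>
        SocialLearning.belief N A L θTX μ₀ (fun j l => ξ l j ω) i k θ
      -- almost sure limits of the belief in the transmitted hypothesis
      (θTX ≠ θ₀ → ∀ k, ∀ᵐ ω ∂P, Tendsto (fun i => μ i k θTX ω) atTop (𝓝 0)) ∧
      (θTX = θ₀ → ∀ k, ∀ᵐ ω ∂P, Tendsto (fun i => μ i k θTX ω) atTop (𝓝 (1 / (1 + ρ)))) ∧
      -- the threshold test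
      (∀ τ : ℝ, 0 < τ → τ < 1 / (1 + ρ) → ∀ k,
        Tendsto (fun i => P {ω | SocialLearning.ClassifiesCorrectly θ₀ θTX τ (μ i k θTX ω)})
          atTop (𝓝 1)) ∧
      -- the choice of the threshold through the minimal initial belief
      (∀ ε : ℝ, 0 < ε → ε < SocialLearning.minInitialBelief μ₀ →
        (0 < SocialLearning.minInitialBelief μ₀ - ε ∧
          SocialLearning.minInitialBelief μ₀ - ε < 1 / (1 + ρ)) ∧
        ∀ k, Tendsto
          (fun i => P {ω | SocialLearning.ClassifiesCorrectly θ₀ θTX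
            (SocialLearning.minInitialBelief μ₀ - ε) (μ i k θTX ω)})
          atTop (𝓝 1)) := by

  obtain ⟨c, -⟩ := id hconn.2
  refine ⟨SocialLearning.existsUnique_perronVector hA.nonneg hA.col_sum hconn, fun v hv => ?_⟩
  intro ρ μ
  have hρ0 : 0 ≤ ρ := SocialLearning.networkConfusionRatio_nonneg hμ₀
  have hpos : ∀ᵐ ω ∂P, ∀ i k θ, 0 < L k θ (ξ k i ω) := by
    simp only [ae_all_iff]
    exact fun i k θ => hξ.ae_of_ae_law (SocialLearning.ae_likelihood_pos hL hKL k θ₀ θ) i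
  have hslln : ∀ᵐ ω ∂P, ∀ k θ, Tendsto (fun n : ℕ => (∑ j ∈ Finset.range n,
      Real.log ((L k θ₀ (ξ k j ω) : ℝ) / L k θ (ξ k j ω))) / n) atTop
      (𝓝 (SocialLearning.divergence ν L k θ₀ θ).toReal) := by
    simp only [ae_all_iff]
    exact fun k θ => hξ.ae_tendsto_average_log_ratio hL hKL k θ
  have hself : ∀ k, (SocialLearning.divergence ν L k θ₀ θ₀).toReal = 0 := fun k => by
    have := SocialLearning.isProbabilityMeasure_law hL k
    rw [SocialLearning.divergence, InformationTheory.klDiv_self, ENNReal.toReal_zero]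
  have hdpos : ∀ k θ, SocialLearning.divergence ν L k θ₀ θ ≠ 0 →
      0 < (SocialLearning.divergence ν L k θ₀ θ).toReal := fun k θ h =>
    ENNReal.toReal_pos h (hKL k θ₀ θ).ne
  have hmem : ∀ k θ, θ ∈ SocialLearning.indistinguishable ν L θ₀ k ↔
      θ ≠ θ₀ ∧ SocialLearning.divergence ν L k θ₀ θ = 0 := fun k θ => by
    simp [SocialLearning.indistinguishable]
  have hfalse : θTX ≠ θ₀ → ∀ k, ∀ᵐ ω ∂P, Tendsto (fun i => μ i k θTX ω) atTop (𝓝 0) := by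
    intro hTX k
    obtain ⟨l, hl⟩ := hident θTX hTX
    filter_upwards [hpos, hslln] with ω hx hd
    exact SocialLearning.tendsto_belief_of_false hA hconn hv hμ₀ hx hd
      (fun _ _ => ENNReal.toReal_nonneg) hself hTX
      ⟨l, hdpos l θTX (Finset.mem_filter.mp hl).2⟩ k
  have htrue : θTX = θ₀ →
      ∀ k, ∀ᵐ ω ∂P, Tendsto (fun i => μ i k θTX ω) atTop (𝓝 (1 / (1 + ρ))) := by
    rintro rfl k
    -- One unconfused agent makes its factor `0 ^ v l`, and hence `ρ`, vanish; this separates the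
    -- two scales.
    by_cases hI : ∀ l, (SocialLearning.indistinguishable ν L θTX l).Nonempty
    · have heq : ∀ᵐ ω ∂P, ∀ l, ∀ θ ∈ SocialLearning.indistinguishable ν L θTX l, ∀ i,
          L l θ (ξ l i ω) = L l θTX (ξ l i ω) := by
        simp only [ae_all_iff]
        exact fun l θ hθ i => hξ.ae_of_ae_law
          (SocialLearning.ae_eq_of_divergence_eq_zero hL ((hmem l θ).mp hθ).2) i
      filter_upwards [hpos, hslln, heq] with ω hx hd he
      exact SocialLearning.tendsto_belief_of_true_of_confused hA hconn hv hμ₀ hx hd hI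
        (fun l h => ((hmem l _).mp h).1 rfl) he
        (fun l θ hθ hθI => hdpos l θ fun h => hθI ((hmem l θ).mpr ⟨hθ, h⟩)) k
    · push Not at hI
      obtain ⟨l, hl⟩ := hI
      have hρ : ρ = 0 := SocialLearning.networkConfusionRatio_eq_zero hv.pos hl
      rw [hρ, add_zero, div_one]
      filter_upwards [hpos, hslln] with ω hx hd
      -- With a single hypothesis the log-odds have no alternative to compare with, and the belief
      -- is identically one.
      rcases (Finset.univ.erase θTX).eq_empty_or_nonempty with hE | hE
      · refine tendsto_const_nhds.congr fun i => (SocialLearning.belief_eq_one (fun θ => ?_) hμ₀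
          hx i k).symm
        by_contra h
        exact Finset.notMem_empty θ (hE ▸ Finset.mem_erase.mpr ⟨h, Finset.mem_univ θ⟩)
      · refine SocialLearning.tendsto_belief_of_true_of_unconfused hA hconn hv hμ₀ hx hd
          (fun _ _ => ENNReal.toReal_nonneg) hself hE ⟨l, fun θ hθ => hdpos l θ fun h => ?_⟩ k
        exact Finset.notMem_empty θ (hl ▸ (hmem l θ).mpr ⟨hθ, h⟩)
  have htest : ∀ τ : ℝ, 0 < τ → τ < 1 / (1 + ρ) → ∀ k,
      Tendsto (fun i => P {ω | SocialLearning.ClassifiesCorrectly θ₀ θTX τ (μ i k θTX ω)})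
        atTop (𝓝 1) := by
    intro τ hτ0 hτ1 k
    refine SocialLearning.tendsto_measure_one_of_ae_eventually ?_
    -- The threshold lies strictly between the two possible limits, so almost surely the test is
    -- eventually correct.
    by_cases hTX : θTX = θ₀
    · filter_upwards [htrue hTX k] with ω hω
      filter_upwards [hω.eventually_const_lt hτ1] with i hi
      exact ⟨fun _ => hTX, fun _ => hi⟩
    · filter_upwards [hfalse hTX k] with ω hω
      filter_upwards [hω.eventually_lt_const hτ0] with i hi
      exact ⟨fun h => absurd h hi.le.not_gt, fun h => absurd h hTX⟩
  refine ⟨hfalse, htrue, htest, fun ε hε hεm => ?_⟩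
  have hlt : SocialLearning.minInitialBelief μ₀ - ε < 1 / (1 + ρ) := by
    have h1 : SocialLearning.minInitialBelief μ₀ ≤ 1 / (1 + ρ) :=
      SocialLearning.minInitialBelief_le_one_div hμ₀ hv.pos hv.sum_eq_one (hε.trans hεm)
    linarith
  exact ⟨⟨sub_pos.mpr hεm, hlt⟩, htest _ (sub_pos.mpr hεm) hlt⟩
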